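/- A time scale is a nonempty closed subset $\mathbb T$ of $\mathbb R$, with forward jump $\sigma(t)=\inf\{s\in\mathbb T: s>t\}$ and backward jump $\rho(t)=\sup\{s\in\mathbb T: s<t\}$ (with $\inf\emptyset=\sup\mathbb T$, $\sup\emptyset=\inf\mathbb T$); $\mathbb T^k=\mathbb T\setminus(\rho(b),b]$ if $\mathbb T$ has a maximum $b$, $\mathbb T^k=\mathbb T$ otherwise, and $\mathbb T^{k^2}=(\mathbb T^k)^k$. A function $f:\mathbb T\to\mathbb R$ has delta derivative $f^\Delta(t)$ at $t\in\mathbb T^k$ if for every $\varepsilon>0$ there is a neighbourhood $U$ of $t$ in $\mathbb T$ with $|f(\sigma(t))-f(s)-f^\Delta(t)(\sigma(t)-s)|\le\varepsilon|\sigma(t)-s|$ for all $s\in U$. The integral $\int_a^b f(t)\,\Delta t$ is $F(b)-F(a)$, where $F$ is an antiderivative of $f$ on $[a,b]\cap\mathbb T$ ($F^\Delta=f$ on $([a,b]\cap\mathbb T)^k$). The double Riemann delta integral over $[a_1,b_1)\times[a_2,b_2)$ of a bounded function is the limit of tagged Riemann sums over products of partitions $a_i=x_0<\dots<x_n=b_i$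 by points of $\mathbb T_i$, with tags in the cells $[x_{j-1},x_j)\times[y_{l-1},y_l)$, where, for fineness $\delta\to0$, every $[x_{j-1},x_j)$ has length at most $\delta$ or satisfies $\rho_i(x_j)=x_{j-1}$. For $i=1,2$ let $a_i<b_i$ be points of a time scale, and let $\mathbb T_i=[a_i,b_i]$ denote the part of that time scale between $a_i$ and $b_i$, regarded as a time scale itself with jump operators $\sigma_i,\rho_i$ and partial delta derivatives $\Delta_i$. Put $R=\mathbb T_1\times\mathbb T_2$. Assume: 1. $\sigma_i$ is delta differentiable on $\mathbb T_i^k$ ($i=1,2$); 2. $L:\mathbb T_1^k\times\mathbb T_2^k\times\mathbb R^3\to\mathbb R$, $(t_1,t_2,y_0,y_1,y_2)\mapsto L$, has partial derivatives $L_{y_0},L_{y_1},L_{y_2}$, and $\tilde u:R\to\mathbb R$ has partial delta derivatives $\tilde u^{\Delta_1}$ on $\mathbb T_1^k\times\mathbb T_2$ and $\tilde u^{\Delta_2}$ on $\mathbb T_1\times\mathbb T_2^k$; write $$(\cdot\cdot)=\bigl(t_1,t_2,\tilde u(\sigma_1(t_1),\sigma_2(t_2)),\tilde u^{\Delta_1}(t_1,\sigma_2(t_2)),\tilde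 u^{\Delta_2}(\sigma_1(t_1),t_2)\bigr);$$ 3. ($L$ is smooth enough) the functions $(t_1,t_2)\mapsto L_{y_j}(\cdot\cdot)$, $j=0,1,2$, are continuous on $\mathbb T_1^k\times\mathbb T_2^k$, and on $\mathbb T_1^{k^2}\times\mathbb T_2^{k^2}$ the partial delta derivatives $L_{y_1}^{\Delta_1}(\cdot\cdot)$ and $L_{y_2}^{\Delta_2}(\cdot\cdot)$ of $L_{y_1}(\cdot\cdot)$ with respect to $t_1$ and of $L_{y_2}(\cdot\cdot)$ with respect to $t_2$ exist and are continuous; 4. $\eta:R\to\mathbb R$ is continuous, has continuous partial delta derivatives $\eta^{\Delta_1}$ on $\mathbb T_1^k\times\mathbb T_2$ and $\eta^{\Delta_2}$ on $\mathbb T_1\times\mathbb T_2^k$ (for instance, $\eta$ has continuous partial delta derivatives up to the second order), and $\eta(t_1,t_2)=0$ whenever $t_1\in\{a_1,b_1\}$ or $t_2\in\{a_2,b_2\}$. Then the two integrals below exist, both as double Riemann delta integrals (over $[a_1,b_1)\times[a_2,b_2)$ and $[a_1,\rho_1(b_1))\times[a_2,\rho_2(b_2))$, respectively) and as iterated integrals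 in the displayed order, all these integrals having the same value: $$\int_{a_1}^{b_1}\!\int_{a_2}^{b_2}\Bigl[L_{y_0}(\cdot\cdot)\,\eta(\sigma_1(t_1),\sigma_2(t_2))+L_{y_1}(\cdot\cdot)\,\eta^{\Delta_1}(t_1,\sigma_2(t_2))+L_{y_2}(\cdot\cdot)\,\eta^{\Delta_2}(\sigma_1(t_1),t_2)\Bigr]\Delta t_2\,\Delta t_1$$ $$=\int_{a_2}^{\rho_2(b_2)}\!\int_{a_1}^{\rho_1(b_1)}\Bigl[L_{y_0}(\cdot\cdot)-L_{y_1}^{\Delta_1}(\cdot\cdot)-L_{y_2}^{\Delta_2}(\cdot\cdot)\Bigr]\eta(\sigma_1(t_1),\sigma_2(t_2))\,\Delta t_1\,\Delta t_2 .$$ -/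

import Mathlib

open Set

noncomputable section

namespace TimeScale

/-- Forward jump operator of the time scale `T`, with the convention `inf ∅ = sup T`. -/
def forwardJump (T : Set ℝ) (t : ℝ) : ℝ :=
  open Classical in
  if (T ∩ Ioi t).Nonempty then sInf (T ∩ Ioi t) else sSup T

/-- Backward jump operator of the time scale `T`, with the convention `sup ∅ = inf T`. -/
def backwardJump (T : Set ℝ) (t : ℝ) : ℝ :=
  open Classical in
  if (T ∩ Iio t).Nonempty then sSup (T ∩ Iio t) else sInf T

/-- `T^k = T \ (ρ(b), b]` where `b` is the maximum of `T`; if `T` has no maximum, nothing is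
removed. -/
def kappa (T : Set ℝ) : Set ℝ :=
  {t ∈ T | ∀ b, IsGreatest T b → t ∉ Ioc (backwardJump T b) b}

/-- `f : T → ℝ` is delta differentiable at `t ∈ T^k` with delta derivative `c`. Functions on `T` are
represented by functions on `ℝ`; only the values on `T` are used. -/
def HasDeltaDerivAt (T : Set ℝ) (f : ℝ → ℝ) (c t : ℝ) : Prop :=
  t ∈ kappa T ∧
  ∀ ε > 0, ∃ δ > 0, ∀ s ∈ T, |s - t| < δ →
    |f (forwardJump T t) - f s - c * (forwardJump T t - s)| ≤ ε * |forwardJump T t - s|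

/-- `∫_a^b f(t) Δt = I` (for `a ≤ b` in `T`): on the time scale `[a, b] ∩ T`
the function `f` has an antiderivative `F`, and `I = F(b) - F(a)`. -/
def HasDeltaIntegral (T : Set ℝ) (f : ℝ → ℝ) (a b I : ℝ) : Prop :=
  ∃ F : ℝ → ℝ, (∀ t ∈ kappa (T ∩ Icc a b), HasDeltaDerivAt (T ∩ Icc a b) F (f t) t) ∧
    I = F b - F a

/-- The iterated integral `∫_a^b (∫_{a'}^{b'} f(s, t) Δ't) Δs` exists and equals `I`; the outer
variable `s` runs through `T` and is the first argument of `f`, the inner one runs through `T'`. -/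
def HasIteratedDeltaIntegral (T T' : Set ℝ) (f : ℝ → ℝ → ℝ) (a b a' b' I : ℝ) : Prop :=
  ∃ g : ℝ → ℝ, (∀ s ∈ kappa (T ∩ Icc a b), HasDeltaIntegral T' (f s) a' b' (g s)) ∧
    HasDeltaIntegral T g a b I

/-- `a = x 0 < x 1 < ⋯ < x n = b` is a partition of `[a, b)` by points of `T`, and every
subinterval either has length at most `δ` or is a jump `[ρ(x (i+1)), x (i+1))` of `T`. -/
def IsDeltaPartition (T : Set ℝ) (a b δ : ℝ) (n : ℕ) (x : ℕ → ℝ) : Prop :=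
  x 0 = a ∧ x n = b ∧ (∀ i ≤ n, x i ∈ T) ∧ (∀ i < n, x i < x (i + 1)) ∧
    ∀ i < n, x (i + 1) - x i ≤ δ ∨ backwardJump T (x (i + 1)) = x i

/-- The double Riemann delta integral of `f` over `[a₁, b₁) × [a₂, b₂)` (intersected with
`T₁ × T₂`) exists and equals `I`: `f` is bounded there, and all Riemann sums over sufficiently fine
partitions, with arbitrary tags in the cells, are close to `I`. -/
def HasDoubleDeltaIntegral (T₁ T₂ : Set ℝ) (f : ℝ → ℝ → ℝ) (a₁ b₁ a₂ b₂ I : ℝ) : Prop :=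
  (∃ M : ℝ, ∀ t₁ ∈ T₁ ∩ Ico a₁ b₁, ∀ t₂ ∈ T₂ ∩ Ico a₂ b₂, |f t₁ t₂| ≤ M) ∧
  ∀ ε > 0, ∃ δ > 0, ∀ (n m : ℕ) (x y : ℕ → ℝ) (ξ ζ : ℕ → ℕ → ℝ),
    IsDeltaPartition T₁ a₁ b₁ δ n x → IsDeltaPartition T₂ a₂ b₂ δ m y →
    (∀ i < n, ∀ j < m, ξ i j ∈ T₁ ∩ Ico (x i) (x (i + 1)) ∧
      ζ i j ∈ T₂ ∩ Ico (y j) (y (j + 1))) →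
    |∑ i ∈ Finset.range n, ∑ j ∈ Finset.range m,
        f (ξ i j) (ζ i j) * ((x (i + 1) - x i) * (y (j + 1) - y j)) - I| < ε

/-- The function `F` of `(t₁, t₂, y₀, y₁, y₂)` evaluated at
`(t₁, t₂, u(σ₁(t₁), σ₂(t₂)), u₁(t₁, σ₂(t₂)), u₂(σ₁(t₁), t₂))`, where `u₁` and `u₂` stand for the
partial delta derivatives of `u`. -/
def along (T₁ T₂ : Set ℝ) (u u₁ u₂ : ℝ → ℝ → ℝ) (F : ℝ → ℝ → ℝ → ℝ → ℝ → ℝ)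
    (t₁ t₂ : ℝ) : ℝ :=
  F t₁ t₂ (u (forwardJump T₁ t₁) (forwardJump T₂ t₂)) (u₁ t₁ (forwardJump T₂ t₂))
    (u₂ (forwardJump T₁ t₁) t₂)

/-- `f₁` and `f₂` are the partial delta derivatives of `f : T₁ × T₂ → ℝ`, the first one defined on
`T₁^k × T₂`, the second one on `T₁ × T₂^k`. -/
def HasPartialDeltaDerivs (T₁ T₂ : Set ℝ) (f f₁ f₂ : ℝ → ℝ → ℝ) : Prop :=
  (∀ t₁ ∈ kappa T₁, ∀ t₂ ∈ T₂, HasDeltaDerivAt T₁ (fun s => f s t₂) (f₁ t₁ t₂) t₁) ∧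
  (∀ t₁ ∈ T₁, ∀ t₂ ∈ kappa T₂, HasDeltaDerivAt T₂ (fun s => f t₁ s) (f₂ t₁ t₂) t₂)

end TimeScale

end

open TimeScale

/-!
For a compact time scale `S` with minimum `a` and maximum `b`, let `⌊x⌋` be the largest point of `S`
not exceeding `x` (`floorPt`). The delta integral of a continuous function is the Lebesgue integral
`∫ x in a..b, f ⌊x⌋` (`deltaIntegral`): its indefinite integral is an antiderivative of `f`
(`hasDeltaDerivAt_integral`), and antiderivatives are unique up to constants
(`eq_of_hasDeltaDerivAt_zero`). A function continuous on the compact set `S^k` is the restriction of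
a bounded continuous function on the line, and `x ↦ ⌊x⌋` is monotone, so measurability and
integrability are automatic. Fubini's theorem for delta integrals follows from the classical one
(`deltaIntegral_swap`), and double Riemann sums converge to the iterated integral by uniform
continuity (`hasDoubleDeltaIntegral_deltaIntegral`).

Differentiability of `σᵢ` makes `σᵢ` continuous, so both integrands of the theorem are continuous on
their domains and all four integrals exist; it remains to compare the values. The three summands
of the first integrand are treated separately. The one with `η(σ₁, σ₂)` vanishes on the last gap
`[ρᵢ(bᵢ), bᵢ)`, where `σᵢ` takes the value `bᵢ`. In the other two, integration by parts in one
variable (`deltaIntegral_mul_eq_neg`) moves the derivative from `η` to `L_{y₁}`, `L_{y₂}`; the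
boundary term at `ρᵢ(bᵢ)` cancels the contribution of the last gap. Continuity of `σᵢ` enters here
once more: it excludes that a left-scattered `bᵢ` is preceded by a left-dense point, where the jump
operators of `Sᵢ` and of `Sᵢ^k` would differ (`forwardJump_kappa`).
-/

open Filter Topology MeasureTheory Asymptotics

namespace TimeScale

/-! ### Compact time scales and their jump operators -/

/-- `S` is a compact time scale with minimum `a` and maximum `b`. -/
structure IsScaleOn (S : Set ℝ) (a b : ℝ) : Prop where
  isClosed : IsClosed S
  isLeast : IsLeast S a
  isGreatest : IsGreatest S b

variable {S : Set ℝ} {a b t s x : ℝ}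

theorem isScaleOn_inter_Icc {T : Set ℝ} (hT : IsClosed T) (ha : a ∈ T) (hb : b ∈ T)
    (hab : a ≤ b) : IsScaleOn (T ∩ Icc a b) a b where
  isClosed := hT.inter isClosed_Icc
  isLeast := ⟨⟨ha, le_rfl, hab⟩, fun _ h => h.2.1⟩
  isGreatest := ⟨⟨hb, hab, le_rfl⟩, fun _ h => h.2.2⟩

namespace IsScaleOn

theorem left_mem (h : IsScaleOn S a b) : a ∈ S := h.isLeast.1

theorem right_mem (h : IsScaleOn S a b) : b ∈ S := h.isGreatest.1

theorem left_le (h : IsScaleOn S a b) (ht : t ∈ S) : a ≤ t := h.isLeast.2 ht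

theorem le_right (h : IsScaleOn S a b) (ht : t ∈ S) : t ≤ b := h.isGreatest.2 ht

theorem le (h : IsScaleOn S a b) : a ≤ b := h.left_le h.right_mem

theorem subset_Icc (h : IsScaleOn S a b) : S ⊆ Icc a b := fun _ ht => ⟨h.left_le ht, h.le_right ht⟩

theorem inter_Icc (h : IsScaleOn S a b) : S ∩ Icc a b = S := inter_eq_left.2 h.subset_Icc

theorem isCompact (h : IsScaleOn S a b) : IsCompact S :=
  isCompact_Icc.of_isClosed_subset h.isClosed h.subset_Icc

theorem forwardJump_mem (h : IsScaleOn S a b) : forwardJump S t ∈ S := by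
  unfold forwardJump
  split_ifs with hne
  · have hsub : closure (S ∩ Ioi t) ⊆ S := h.isClosed.closure_subset_iff.2 inter_subset_left
    exact hsub (csInf_mem_closure hne ⟨t, fun s hs => le_of_lt hs.2⟩)
  · rw [h.isGreatest.csSup_eq]; exact h.right_mem

theorem le_forwardJump (h : IsScaleOn S a b) (ht : t ∈ S) : t ≤ forwardJump S t := by
  unfold forwardJump
  split_ifs with hne
  · exact le_csInf hne fun s hs => le_of_lt hs.2
  · rw [h.isGreatest.csSup_eq]; exact h.le_right ht

theorem forwardJump_le_of_lt (hs : s ∈ S) (hts : t < s) : forwardJump S t ≤ s := by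
  unfold forwardJump
  rw [if_pos ⟨s, hs, hts⟩]
  exact csInf_le ⟨t, fun s hs => le_of_lt hs.2⟩ ⟨hs, hts⟩

theorem le_of_lt_forwardJump (hs : s ∈ S) (hst : s < forwardJump S t) : s ≤ t :=
  not_lt.1 fun hlt => absurd (forwardJump_le_of_lt hs hlt) (not_le.2 hst)

theorem forwardJump_right (h : IsScaleOn S a b) : forwardJump S b = b :=
  le_antisymm (h.le_right h.forwardJump_mem) (h.le_forwardJump h.right_mem)

theorem le_backwardJump_of_lt (hs : s ∈ S) (hst : s < t) : s ≤ backwardJump S t := by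
  unfold backwardJump
  rw [if_pos ⟨s, hs, hst⟩]
  exact le_csSup ⟨t, fun s hs => le_of_lt hs.2⟩ ⟨hs, hst⟩

theorem backwardJump_mem (h : IsScaleOn S a b) : backwardJump S t ∈ S := by
  unfold backwardJump
  split_ifs with hne
  · have hsub : closure (S ∩ Iio t) ⊆ S := h.isClosed.closure_subset_iff.2 inter_subset_left
    exact hsub (csSup_mem_closure hne ⟨t, fun s hs => le_of_lt hs.2⟩)
  · rw [h.isLeast.csInf_eq]; exact h.left_mem

theorem kappa_eq (h : IsScaleOn S a b) : kappa S = S ∩ Icc a (backwardJump S b) := by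
  ext t
  constructor
  · rintro ⟨ht, hb⟩
    refine ⟨ht, h.left_le ht, not_lt.1 fun hlt => hb b h.isGreatest ⟨hlt, h.le_right ht⟩⟩
  · rintro ⟨ht, -, htb⟩
    refine ⟨ht, fun c hc hcc => ?_⟩
    rw [hc.unique h.isGreatest] at hcc
    exact absurd hcc.1 (not_lt.2 htb)

theorem mem_kappa_of_lt (h : IsScaleOn S a b) (ht : t ∈ S) (htb : t < b) : t ∈ kappa S := by
  rw [h.kappa_eq]
  exact ⟨ht, h.left_le ht, le_backwardJump_of_lt ht htb⟩

theorem isScaleOn_kappa (h : IsScaleOn S a b) : IsScaleOn (kappa S) a (backwardJump S b) := by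
  rw [h.kappa_eq]
  exact isScaleOn_inter_Icc h.isClosed h.left_mem h.backwardJump_mem (h.left_le h.backwardJump_mem)

/-- If the maximum `b` is left-scattered, then `ρ(b)` jumps to `b`. -/
theorem forwardJump_backwardJump_right (h : IsScaleOn S a b) (hb : backwardJump S b < b) :
    forwardJump S (backwardJump S b) = b := by
  refine le_antisymm (forwardJump_le_of_lt h.right_mem hb) ?_
  unfold forwardJump
  rw [if_pos ⟨b, h.right_mem, hb⟩]
  refine le_csInf ⟨b, h.right_mem, hb⟩ fun s hs => ?_
  by_contra hlt
  exact absurd (le_backwardJump_of_lt hs.1 (not_le.1 hlt)) (not_le.2 hs.2)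

theorem backwardJump_right_le (h : IsScaleOn S a b) : backwardJump S b ≤ b :=
  h.le_right h.backwardJump_mem

/-- Arbitrarily close to a point of `S^k` there are points of `S` other than its forward jump. -/
theorem exists_ne_forwardJump (h : IsScaleOn S a b) (hab : a < b) (ht : t ∈ kappa S) {δ : ℝ}
    (hδ : 0 < δ) : ∃ s ∈ S, |s - t| < δ ∧ s ≠ forwardJump S t := by
  by_cases hσ : forwardJump S t = t
  · rw [hσ]
    rcases (h.le_right ht.1).lt_or_eq with htb | rfl
    · have hne : (S ∩ Ioi t).Nonempty := ⟨b, h.right_mem, htb⟩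
      have hinf : sInf (S ∩ Ioi t) < t + δ := by
        have : forwardJump S t = sInf (S ∩ Ioi t) := if_pos hne
        linarith
      obtain ⟨s, hs, hst⟩ := exists_lt_of_csInf_lt hne hinf
      have hs2 : t < s := hs.2
      exact ⟨s, hs.1, by rw [abs_of_pos] <;> linarith, hs2.ne'⟩
    · have hρ : backwardJump S t = t := by
        rw [h.kappa_eq] at ht
        exact le_antisymm h.backwardJump_right_le ht.2.2
      have hne : (S ∩ Iio t).Nonempty := ⟨a, h.left_mem, hab⟩
      have hsup : t - δ < sSup (S ∩ Iio t) := by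
        have : backwardJump S t = sSup (S ∩ Iio t) := if_pos hne
        linarith
      obtain ⟨s, hs, hst⟩ := exists_lt_of_lt_csSup hne hsup
      have hs2 : s < t := hs.2
      exact ⟨s, hs.1, by rw [abs_of_neg] <;> linarith, hs2.ne⟩
  · exact ⟨t, ht.1, by simpa using hδ, Ne.symm hσ⟩

end IsScaleOn

/-! ### Delta derivatives -/

theorem hasDeltaDerivAt_iff_isLittleO {f : ℝ → ℝ} {c : ℝ} :
    HasDeltaDerivAt S f c t ↔ t ∈ kappa S ∧
      (fun s => f (forwardJump S t) - f s - c * (forwardJump S t - s)) =o[𝓝[S] t]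
        fun s => forwardJump S t - s := by
  refine and_congr_right fun _ => ?_
  rw [isLittleO_iff]
  refine forall_congr' fun ε => imp_congr_right fun _ => ?_
  rw [Metric.nhdsWithin_basis_ball.eventually_iff]
  simp only [Metric.mem_ball, Real.dist_eq, mem_inter_iff, Real.norm_eq_abs, gt_iff_lt]
  exact exists_congr fun δ => and_congr_right fun _ =>
    ⟨fun H s hs => H s hs.2 hs.1, fun H s hs hst => H ⟨hst, hs⟩⟩

namespace HasDeltaDerivAt

variable {f g : ℝ → ℝ} {c d : ℝ}

theorem mem (hf : HasDeltaDerivAt S f c t) : t ∈ S := hf.1.1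

theorem isLittleO (hf : HasDeltaDerivAt S f c t) :
    (fun s => f (forwardJump S t) - f s - c * (forwardJump S t - s)) =o[𝓝[S] t]
        fun s => forwardJump S t - s :=
  (hasDeltaDerivAt_iff_isLittleO.1 hf).2

/-- The value of `f` at the forward jump, `f(σ(t)) = f(t) + f^Δ(t) (σ(t) - t)`. -/
theorem apply_forwardJump (hf : HasDeltaDerivAt S f c t) :
    f (forwardJump S t) - f t = c * (forwardJump S t - t) := by
  have h1 : (fun s => f (forwardJump S t) - f s - c * (forwardJump S t - s)) =o[pure t]
      fun s => forwardJump S t - s := hf.isLittleO.mono (pure_le_nhdsWithin hf.mem)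
  have h2 := isLittleO_pure.1 h1
  linarith

theorem continuousWithinAt (hf : HasDeltaDerivAt S f c t) : ContinuousWithinAt f S t := by
  have hid : Tendsto (fun s : ℝ => forwardJump S t - s) (𝓝[S] t) (𝓝 (forwardJump S t - t)) :=
    (continuous_const.sub continuous_id).continuousWithinAt
  have h0 := (hf.isLittleO.trans_isBigO (hid.isBigO_one ℝ))
  rw [isLittleO_one_iff] at h0
  have h1 := (tendsto_const_nhds (x := f (forwardJump S t))).sub (h0.add (hid.const_mul c))
  have e : f (forwardJump S t) - (0 + c * (forwardJump S t - t)) = f t := by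
    linarith [hf.apply_forwardJump]
  rw [e] at h1
  exact h1.congr fun s => by ring

/-- The delta derivative of a function vanishing on `S` is zero. The condition `a < b` is needed: on a
time scale with one point every number is a delta derivative. -/
theorem eq_zero {a b : ℝ} (h : IsScaleOn S a b) (hab : a < b) (hf : HasDeltaDerivAt S f c t)
    (h0 : ∀ s ∈ S, f s = 0) : c = 0 := by
  by_contra hc
  obtain ⟨δ, hδ, H⟩ := hf.2 (|c| / 2) (half_pos (abs_pos.2 hc))
  obtain ⟨s, hs, hst, hne⟩ := h.exists_ne_forwardJump hab hf.1 hδ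
  have h1 := H s hs hst
  rw [h0 _ h.forwardJump_mem, h0 s hs, sub_zero, zero_sub, abs_neg, abs_mul] at h1
  have h2 : 0 < |forwardJump S t - s| := abs_pos.2 (sub_ne_zero.2 hne.symm)
  have h3 : 0 < |c| := abs_pos.2 hc
  nlinarith

theorem sub (hf : HasDeltaDerivAt S f c t) (hg : HasDeltaDerivAt S g d t) :
    HasDeltaDerivAt S (fun s => f s - g s) (c - d) t :=
  hasDeltaDerivAt_iff_isLittleO.2
    ⟨hf.1, (hf.isLittleO.sub hg.isLittleO).congr_left fun s => by ring⟩

/-- The product rule `(fg)^Δ = f g^Δ + f^Δ g^σ`. -/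
theorem mul (hf : HasDeltaDerivAt S f c t) (hg : HasDeltaDerivAt S g d t) :
    HasDeltaDerivAt S (fun s => f s * g s) (f t * d + c * g (forwardJump S t)) t := by
  refine hasDeltaDerivAt_iff_isLittleO.2 ⟨hf.1, ?_⟩
  have h1 := hf.isLittleO.const_mul_left (g (forwardJump S t))
  have h2 : (fun s => f s * (g (forwardJump S t) - g s - d * (forwardJump S t - s))) =o[𝓝[S] t]
      fun s => forwardJump S t - s := by
    simpa using (hf.continuousWithinAt.isBigO_one ℝ).mul_isLittleO hg.isLittleO
  have h3 : (fun s => (f s - f t) * (d * (forwardJump S t - s))) =o[𝓝[S] t]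
      fun s => forwardJump S t - s := by
    have h4 : Tendsto (fun s => f s - f t) (𝓝[S] t) (𝓝 0) := by
      simpa using hf.continuousWithinAt.sub_const (f t)
    simpa using ((isLittleO_one_iff ℝ).2 h4).mul_isBigO
      ((isBigO_refl (fun s => forwardJump S t - s) (𝓝[S] t)).const_mul_left d)
  exact ((h1.add h2).add h3).congr_left fun s => by ring

/-- Restriction to a smaller time scale in which `t` has the same forward jump. -/
theorem mono {K : Set ℝ} (hf : HasDeltaDerivAt S f c t) (hKS : K ⊆ S) (ht : t ∈ kappa K)
    (hσ : forwardJump K t = forwardJump S t) : HasDeltaDerivAt K f c t := by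
  refine ⟨ht, fun ε hε => ?_⟩
  obtain ⟨δ, hδ, H⟩ := hf.2 ε hε
  rw [hσ]
  exact ⟨δ, hδ, fun s hs hst => H s (hKS hs) hst⟩

end HasDeltaDerivAt

/-- A function with vanishing delta derivative is constant. Given `ε > 0`, the set of points up to
which `|f(s) - f(a)| ≤ ε (s - a)` holds is closed under limits and cannot end before `b`. -/
theorem eq_of_hasDeltaDerivAt_zero {f : ℝ → ℝ} (h : IsScaleOn S a b)
    (hf : ∀ t ∈ kappa S, HasDeltaDerivAt S f 0 t) : f b = f a := by
  have key : ∀ ε > 0, |f b - f a| ≤ ε * (b - a) := by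
    intro ε hε
    let A : Set ℝ := {t ∈ S | ∀ s ∈ S, s ≤ t → |f s - f a| ≤ ε * (s - a)}
    have haA : a ∈ A := by
      refine ⟨h.left_mem, fun s hs hsa => ?_⟩
      rw [le_antisymm hsa (h.left_le hs)]; simp
    have hAb : BddAbove A := ⟨b, fun t ht => h.le_right ht.1⟩
    set m := sSup A with hm
    have hmcl : m ∈ closure A := csSup_mem_closure ⟨a, haA⟩ hAb
    have hmS : m ∈ S := h.isClosed.closure_subset_iff.2 (sep_subset _ _) hmcl
    have hlt : ∀ s ∈ S, s < m → |f s - f a| ≤ ε * (s - a) := by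
      intro s hs hsm
      obtain ⟨t, ht, hst⟩ := exists_lt_of_lt_csSup ⟨a, haA⟩ hsm
      exact ht.2 s hs hst.le
    have hmA : m ∈ A := by
      by_contra hmA
      -- `m` is then a limit of points of `A` below it, hence lies in `S^k`, where `f` is continuous
      have hlim : ∀ r < m, ∃ t ∈ A, r < t ∧ t < m := by
        intro r hr
        obtain ⟨t, ht, hrt⟩ := exists_lt_of_lt_csSup ⟨a, haA⟩ hr
        exact ⟨t, ht, hrt, lt_of_le_of_ne (le_csSup hAb ht) fun e => hmA (e ▸ ht)⟩
      have hmk : m ∈ kappa S := by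
        rcases (h.le_right hmS).lt_or_eq with hmb | hmb
        · exact h.mem_kappa_of_lt hmS hmb
        · rw [h.kappa_eq]
          refine ⟨hmS, h.left_le hmS, not_lt.1 fun hlt' => ?_⟩
          obtain ⟨t, ht, h1, h2⟩ := hlim _ hlt'
          exact absurd (IsScaleOn.le_backwardJump_of_lt ht.1 (hmb ▸ h2)) (not_le.2 h1)
      have hcl : m ∈ closure (S ∩ Iio m) := by
        rw [Metric.mem_closure_iff]
        intro δ hδ
        obtain ⟨t, ht, h1, h2⟩ := hlim (m - δ) (by linarith)
        exact ⟨t, ⟨ht.1, h2⟩, by rw [Real.dist_eq, abs_of_pos] <;> linarith⟩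
      have hneb : (𝓝[S ∩ Iio m] m).NeBot := mem_closure_iff_nhdsWithin_neBot.1 hcl
      have hcont : Tendsto f (𝓝[S ∩ Iio m] m) (𝓝 (f m)) :=
        (hf m hmk).continuousWithinAt.mono inter_subset_left
      have hle : |f m - f a| ≤ ε * (m - a) := by
        refine le_of_tendsto_of_tendsto (hcont.sub_const (f a)).abs
          (((continuous_id.sub continuous_const).const_mul ε).continuousWithinAt.tendsto) ?_
        exact eventually_nhdsWithin_of_forall fun s hs => hlt s hs.1 hs.2
      refine hmA ⟨hmS, fun s hs hsm => ?_⟩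
      rcases hsm.lt_or_eq with hsm | rfl
      · exact hlt s hs hsm
      · exact hle
    rcases (h.le_right hmS).lt_or_eq with hmb | hmb
    · exfalso
      have hmk := h.mem_kappa_of_lt hmS hmb
      by_cases hσ : forwardJump S m = m
      · -- right-dense: the derivative bound carries the estimate a little further
        obtain ⟨δ, hδ, H⟩ := (hf m hmk).2 ε hε
        have hne : (S ∩ Ioi m).Nonempty := ⟨b, h.right_mem, hmb⟩
        have hinf : sInf (S ∩ Ioi m) < m + δ := by
          have : forwardJump S m = sInf (S ∩ Ioi m) := if_pos hne
          linarith
        obtain ⟨r, hr, hrd⟩ := exists_lt_of_csInf_lt hne hinf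
        have hrm : m < r := hr.2
        have hrA : r ∈ A := by
          refine ⟨hr.1, fun s hs hsr => ?_⟩
          rcases le_or_gt s m with hsm | hsm
          · exact hmA.2 s hs hsm
          · have h1 := H s hs (by rw [abs_of_pos] <;> linarith)
            have h2 := hmA.2 m hmS le_rfl
            rw [hσ, zero_mul, sub_zero, abs_sub_comm, abs_sub_comm m s,
              abs_of_pos (sub_pos.2 hsm)] at h1
            calc |f s - f a| ≤ |f s - f m| + |f m - f a| := abs_sub_le _ _ _
              _ ≤ ε * (s - m) + ε * (m - a) := add_le_add h1 h2
              _ = ε * (s - a) := by ring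
        exact absurd (le_csSup hAb hrA) (not_le.2 hrm)
      · have hlt' : m < forwardJump S m := lt_of_le_of_ne (h.le_forwardJump hmS) (Ne.symm hσ)
        have heq := (hf m hmk).apply_forwardJump
        rw [zero_mul, sub_eq_zero] at heq
        have hσA : forwardJump S m ∈ A := by
          refine ⟨h.forwardJump_mem, fun s hs hsσ => ?_⟩
          rcases hsσ.lt_or_eq with hs' | rfl
          · exact hmA.2 s hs (IsScaleOn.le_of_lt_forwardJump hs hs')
          · rw [heq]
            exact (hmA.2 m hmS le_rfl).trans
              (mul_le_mul_of_nonneg_left (by linarith) hε.le)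
        exact absurd (le_csSup hAb hσA) (not_le.2 hlt')
    · rw [← hmb]
      exact hmA.2 m hmS le_rfl
  have h0 : |f b - f a| ≤ 0 := by
    refine le_of_forall_pos_le_add fun η hη => ?_
    have hab := h.le
    have hp : 0 < b - a + 1 := by linarith
    refine (key (η / (b - a + 1)) (by positivity)).trans ?_
    rw [div_mul_eq_mul_div, div_le_iff₀ hp]
    nlinarith
  exact sub_eq_zero.1 (abs_nonpos_iff.1 h0)

/-! ### The delta integral as a Lebesgue integral -/

/-- The largest point of `S` in `[a, x]`. The point `a` is inserted so that the function is monotone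
on the whole line; it takes the value `a` below `a`. -/
noncomputable def floorPt (S : Set ℝ) (a x : ℝ) : ℝ := sSup (insert a (S ∩ Icc a x))

theorem bddAbove_insert_inter_Icc : BddAbove (insert a (S ∩ Icc a x)) :=
  bddAbove_insert.2 ⟨x, fun _ h => h.2.2⟩

theorem monotone_floorPt : Monotone (floorPt S a) := fun _ _ hxy =>
  csSup_le_csSup bddAbove_insert_inter_Icc (insert_nonempty _ _)
    (insert_subset_insert (inter_subset_inter_right _ (Icc_subset_Icc_right hxy)))

theorem floorPt_inter_Icc {c : ℝ} (hx : x ≤ c) : floorPt (S ∩ Icc a c) a x = floorPt S a x := by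
  unfold floorPt
  rw [inter_assoc, inter_eq_right.2 (Icc_subset_Icc_right hx)]

namespace IsScaleOn

theorem floorPt_mem (h : IsScaleOn S a b) : floorPt S a x ∈ S := by
  have hsub : insert a (S ∩ Icc a x) ⊆ S := insert_subset h.left_mem inter_subset_left
  exact (h.isClosed.closure_subset_iff.2 hsub)
    (csSup_mem_closure (insert_nonempty _ _) bddAbove_insert_inter_Icc)

theorem floorPt_le (hx : a ≤ x) : floorPt S a x ≤ x :=
  csSup_le (insert_nonempty _ _) (by rintro y (rfl | hy); exacts [hx, hy.2.2])

theorem le_floorPt (h : IsScaleOn S a b) (hs : s ∈ S) (hsx : s ≤ x) : s ≤ floorPt S a x :=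
  le_csSup bddAbove_insert_inter_Icc (Or.inr ⟨hs, h.left_le hs, hsx⟩)

theorem floorPt_mem_kappa (h : IsScaleOn S a b) (hx : x ∈ Ioo a b) : floorPt S a x ∈ kappa S :=
  h.mem_kappa_of_lt h.floorPt_mem ((floorPt_le hx.1.le).trans_lt hx.2)

end IsScaleOn

/-- The delta integral over `[a, b)` of a function on a time scale with minimum `a` and maximum `b`,
as a Lebesgue integral: the function is extended to the gaps of the time scale by its value at the
left end of the gap. -/
noncomputable def deltaIntegral (S : Set ℝ) (a b : ℝ) (f : ℝ → ℝ) : ℝ :=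
  ∫ x in a..b, f (floorPt S a x)

theorem deltaIntegral_congr (h : IsScaleOn S a b) {f g : ℝ → ℝ} (hfg : EqOn f g (kappa S)) :
    deltaIntegral S a b f = deltaIntegral S a b g :=
  intervalIntegral.integral_congr_Ioo_of_le h.le fun _ hx => hfg (h.floorPt_mem_kappa hx)

/-- A continuous function on a compact set is the restriction of a bounded continuous function. -/
theorem exists_bounded_continuous_eqOn {X : Type*} [TopologicalSpace X] [T4Space X] {K : Set X}
    (hK : IsCompact K) {f : X → ℝ} (hf : ContinuousOn f K) :
    ∃ (g : X → ℝ) (M : ℝ), Continuous g ∧ (∀ x, |g x| ≤ M) ∧ EqOn f g K := by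
  obtain ⟨g, hg⟩ := ContinuousMap.exists_restrict_eq hK.isClosed ⟨K.domRestrict f, hf.domRestrict⟩
  obtain ⟨M, hM⟩ := hK.exists_bound_of_continuousOn hf
  have hgf : ∀ x ∈ K, g x = f x := fun x hx => DFunLike.congr_fun hg ⟨x, hx⟩
  refine ⟨fun x => max (-|M|) (min |M| (g x)), |M|, by fun_prop, fun x => ?_, fun x hx => ?_⟩
  · have := abs_nonneg M
    exact abs_le.2 ⟨le_max_left _ _, max_le (by linarith) (min_le_left _ _)⟩
  · have h1 := abs_le.1 ((hM x hx).trans (le_abs_self M))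
    simp only [hgf x hx]
    rw [min_eq_right h1.2, max_eq_right h1.1]

theorem intervalIntegrable_of_bounded {f : ℝ → ℝ} (hf : Measurable f) {M : ℝ}
    (hM : ∀ x, |f x| ≤ M) : IntervalIntegrable f volume a b :=
  intervalIntegrable_const (c := M) |>.mono_fun hf.aestronglyMeasurable
    (Eventually.of_forall fun x => (hM x).trans (le_abs_self M))

theorem abs_integral_le_of_abs_le_uIoo {f : ℝ → ℝ} {C : ℝ} (hf : ∀ x ∈ uIoo a b, |f x| ≤ C) :
    |∫ x in a..b, f x| ≤ C * |b - a| := by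
  refine intervalIntegral.norm_integral_le_of_norm_le_const_ae (f := f) ?_
  have hne : ∀ᵐ x : ℝ, x ≠ max a b := compl_mem_ae_iff.2 (measure_singleton _)
  filter_upwards [hne] with x hx hxI
  exact hf x ⟨hxI.1, lt_of_le_of_ne hxI.2 hx⟩

/-- The indefinite integral of a continuous function is an antiderivative: if `s ∈ S` is close to
`t`, then between `s` and `σ(t)` the integrand takes only values at points close to `t`. -/
theorem hasDeltaDerivAt_integral (h : IsScaleOn S a b) {g : ℝ → ℝ} {M : ℝ} (hg : Continuous g)
    (hM : ∀ x, |g x| ≤ M) (ht : t ∈ kappa S) :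
    HasDeltaDerivAt S (fun r => ∫ x in a..r, g (floorPt S a x)) (g t) t := by
  refine ⟨ht, fun ε hε => ?_⟩
  obtain ⟨δ, hδ, H⟩ := Metric.continuousAt_iff.1 hg.continuousAt ε hε
  refine ⟨δ, hδ, fun s hs hst => ?_⟩
  have hint : ∀ p q : ℝ, IntervalIntegrable (fun x => g (floorPt S a x)) volume p q := fun p q =>
    intervalIntegrable_of_bounded (hg.measurable.comp monotone_floorPt.measurable) fun x => hM _
  set τ := forwardJump S t
  have htτ : t ≤ τ := h.le_forwardJump ht.1
  have hτS : τ ∈ S := h.forwardJump_mem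
  have e : (∫ x in a..τ, g (floorPt S a x)) - (∫ x in a..s, g (floorPt S a x)) - g t * (τ - s) =
      ∫ x in s..τ, (g (floorPt S a x) - g t) := by
    rw [intervalIntegral.integral_sub (hint _ _) intervalIntegrable_const,
      intervalIntegral.integral_interval_sub_left (hint _ _) (hint _ _),
      intervalIntegral.integral_const, smul_eq_mul, mul_comm]
  rw [e]
  refine abs_integral_le_of_abs_le_uIoo fun x hx => ?_
  rw [abs_lt] at hst
  have hclose : |floorPt S a x - t| < δ := by
    rw [abs_lt]
    rcases le_total s τ with hsτ | hsτ
    · rw [uIoo_of_le hsτ] at hx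
      have h1 := h.le_floorPt hs hx.1.le
      have h2 : floorPt S a x ≤ t := IsScaleOn.le_of_lt_forwardJump h.floorPt_mem
        ((IsScaleOn.floorPt_le ((h.left_le hs).trans hx.1.le)).trans_lt hx.2)
      constructor <;> linarith
    · rw [uIoo_of_ge hsτ] at hx
      have h1 := h.le_floorPt hτS hx.1.le
      have h2 : floorPt S a x ≤ x := IsScaleOn.floorPt_le ((h.left_le hτS).trans hx.1.le)
      have := hx.2
      constructor <;> linarith
  have := H (x := floorPt S a x) (by rwa [Real.dist_eq])
  rw [Real.dist_eq] at this
  exact this.le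

theorem hasDeltaIntegral_deltaIntegral {T : Set ℝ} (h : IsScaleOn (T ∩ Icc a b) a b) {f : ℝ → ℝ}
    (hf : ContinuousOn f (kappa (T ∩ Icc a b))) :
    HasDeltaIntegral T f a b (deltaIntegral (T ∩ Icc a b) a b f) := by
  obtain ⟨g, M, hg, hM, hfg⟩ := exists_bounded_continuous_eqOn h.isScaleOn_kappa.isCompact hf
  refine ⟨fun r => ∫ x in a..r, g (floorPt (T ∩ Icc a b) a x), fun t ht => ?_, ?_⟩
  · rw [hfg ht]
    exact hasDeltaDerivAt_integral h hg hM ht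
  · simp only [intervalIntegral.integral_same, sub_zero]
    exact deltaIntegral_congr h hfg

theorem deltaIntegral_eq_sub (h : IsScaleOn S a b) {F f : ℝ → ℝ} (hf : ContinuousOn f (kappa S))
    (hF : ∀ t ∈ kappa S, HasDeltaDerivAt S F (f t) t) : deltaIntegral S a b f = F b - F a := by
  obtain ⟨g, M, hg, hM, hfg⟩ := exists_bounded_continuous_eqOn h.isScaleOn_kappa.isCompact hf
  rw [deltaIntegral_congr h hfg]
  have key := eq_of_hasDeltaDerivAt_zero h
    (f := fun r => F r - ∫ x in a..r, g (floorPt S a x)) fun t ht => by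
      have h1 := (hF t ht).sub (hasDeltaDerivAt_integral h hg hM ht)
      rwa [hfg ht, sub_self] at h1
  simp only [intervalIntegral.integral_same] at key
  unfold deltaIntegral
  linarith

theorem intervalIntegrable_comp_floorPt (h : IsScaleOn S a b) {f : ℝ → ℝ}
    (hf : ContinuousOn f (kappa S)) :
    IntervalIntegrable (fun x => f (floorPt S a x)) volume a b := by
  obtain ⟨g, M, hg, hM, hfg⟩ := exists_bounded_continuous_eqOn h.isScaleOn_kappa.isCompact hf
  refine (intervalIntegrable_of_bounded (f := fun x => g (floorPt S a x)) (M := M)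
    (hg.measurable.comp monotone_floorPt.measurable) fun x => hM _).congr_uIoo fun x hx => ?_
  rw [uIoo_of_le h.le] at hx
  exact (hfg (h.floorPt_mem_kappa hx)).symm

theorem deltaIntegral_add (h : IsScaleOn S a b) {f g : ℝ → ℝ} (hf : ContinuousOn f (kappa S))
    (hg : ContinuousOn g (kappa S)) :
    deltaIntegral S a b (fun t => f t + g t) = deltaIntegral S a b f + deltaIntegral S a b g :=
  intervalIntegral.integral_add (intervalIntegrable_comp_floorPt h hf)
    (intervalIntegrable_comp_floorPt h hg)

theorem deltaIntegral_neg (f : ℝ → ℝ) :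
    deltaIntegral S a b (fun t => -f t) = -deltaIntegral S a b f :=
  intervalIntegral.integral_neg

/-- Splitting off the last gap `[ρ(b), b)`. -/
theorem deltaIntegral_eq_kappa_add (h : IsScaleOn S a b) {f : ℝ → ℝ}
    (hf : ContinuousOn f (kappa S)) :
    deltaIntegral S a b f = deltaIntegral (kappa S) a (backwardJump S b) f +
      f (backwardJump S b) * (b - backwardJump S b) := by
  set c := backwardJump S b
  have hac : a ≤ c := h.isScaleOn_kappa.le
  have hcb : c ≤ b := h.backwardJump_right_le
  have hint := intervalIntegrable_comp_floorPt h hf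
  have h1 : deltaIntegral (kappa S) a c f = ∫ x in a..c, f (floorPt S a x) :=
    intervalIntegral.integral_congr_Ioo_of_le hac fun x hx => by
      simp only [h.kappa_eq]
      rw [floorPt_inter_Icc hx.2.le]
  have h2 : ∫ x in c..b, f (floorPt S a x) = ∫ x in c..b, f c :=
    intervalIntegral.integral_congr_Ioo_of_le hcb fun x hx => by
      have h3 : floorPt S a x = c := by
        refine le_antisymm (IsScaleOn.le_backwardJump_of_lt h.floorPt_mem ?_)
          (h.le_floorPt h.backwardJump_mem hx.1.le)
        exact (IsScaleOn.floorPt_le (hac.trans hx.1.le)).trans_lt hx.2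
      simp only [h3]
  rw [intervalIntegral.integral_const, smul_eq_mul, mul_comm] at h2
  rw [h1, ← h2]
  refine (intervalIntegral.integral_add_adjacent_intervals ?_ ?_).symm
  · exact hint.mono_set (by rw [uIcc_of_le hac, uIcc_of_le h.le]; exact Icc_subset_Icc_right hcb)
  · exact hint.mono_set (by rw [uIcc_of_le hcb, uIcc_of_le h.le]; exact Icc_subset_Icc_left hac)

/-! ### Iterated and double delta integrals -/

variable {S₁ S₂ : Set ℝ} {a₁ b₁ a₂ b₂ : ℝ}

theorem continuous_integral_comp_floorPt {g : ℝ × ℝ → ℝ} {M : ℝ} (hg : Continuous g)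
    (hM : ∀ p, |g p| ≤ M) (p q : ℝ) : Continuous fun r => ∫ y in p..q, g (r, floorPt S a y) := by
  refine intervalIntegral.continuous_of_dominated_interval (bound := fun _ => M) (fun r => ?_)
    (fun r => Eventually.of_forall fun x _ => hM _) intervalIntegrable_const
    (Eventually.of_forall fun x _ => by fun_prop)
  have : Measurable fun t => g (r, t) := (by fun_prop : Continuous fun t => g (r, t)).measurable
  exact (this.comp monotone_floorPt.measurable).aestronglyMeasurable

/-- Continuity of a delta integral in a parameter. -/
theorem continuousOn_deltaIntegral (h : IsScaleOn S a b) {K : Set ℝ} (hK : IsCompact K)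
    {f : ℝ → ℝ → ℝ} (hf : ContinuousOn (fun p : ℝ × ℝ => f p.1 p.2) (K ×ˢ kappa S)) :
    ContinuousOn (fun r => deltaIntegral S a b (f r)) K := by
  obtain ⟨g, M, hg, hM, hfg⟩ :=
    exists_bounded_continuous_eqOn (hK.prod h.isScaleOn_kappa.isCompact) hf
  exact continuous_integral_comp_floorPt hg hM a b
    |>.continuousOn.congr fun r hr => deltaIntegral_congr h fun t ht => hfg (mk_mem_prod hr ht)

theorem integrableOn_comp_floorPt {g : ℝ × ℝ → ℝ} {M : ℝ} (hg : Continuous g)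
    (hM : ∀ p, |g p| ≤ M) (p q r s : ℝ) :
    IntegrableOn (Function.uncurry fun x y => g (floorPt S₁ a₁ x, floorPt S₂ a₂ y))
      (uIoc p q ×ˢ uIoc r s) := by
  refine Measure.integrableOn_of_bounded (M := M) ?_ ?_ (Eventually.of_forall fun z => hM _)
  · rw [Measure.volume_eq_prod, Measure.prod_prod, uIoc, uIoc, Real.volume_Ioc, Real.volume_Ioc]
    exact ENNReal.mul_ne_top ENNReal.ofReal_ne_top ENNReal.ofReal_ne_top
  · exact (hg.measurable.comp ((monotone_floorPt.measurable.comp measurable_fst).prodMk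
      (monotone_floorPt.measurable.comp measurable_snd))).aestronglyMeasurable

theorem deltaIntegral_congr₂ (h₁ : IsScaleOn S₁ a₁ b₁) (h₂ : IsScaleOn S₂ a₂ b₂)
    {f g : ℝ → ℝ → ℝ} (hfg : ∀ t₁ ∈ kappa S₁, ∀ t₂ ∈ kappa S₂, f t₁ t₂ = g t₁ t₂) :
    deltaIntegral S₁ a₁ b₁ (fun t₁ => deltaIntegral S₂ a₂ b₂ (f t₁)) =
      deltaIntegral S₁ a₁ b₁ (fun t₁ => deltaIntegral S₂ a₂ b₂ (g t₁)) :=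
  deltaIntegral_congr h₁ fun t₁ ht₁ => deltaIntegral_congr h₂ fun t₂ ht₂ => hfg t₁ ht₁ t₂ ht₂

theorem continuousOn_curry {K₁ K₂ : Set ℝ} {f : ℝ → ℝ → ℝ}
    (hf : ContinuousOn (fun p : ℝ × ℝ => f p.1 p.2) (K₁ ×ˢ K₂)) {t₁ : ℝ} (ht₁ : t₁ ∈ K₁) :
    ContinuousOn (f t₁) K₂ :=
  hf.comp (Continuous.prodMk_right t₁).continuousOn fun _ ht => mk_mem_prod ht₁ ht

theorem continuousOn_prod_swap {K₁ K₂ : Set ℝ} {f : ℝ → ℝ → ℝ}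
    (hf : ContinuousOn (fun p : ℝ × ℝ => f p.1 p.2) (K₁ ×ˢ K₂)) :
    ContinuousOn (fun p : ℝ × ℝ => f p.2 p.1) (K₂ ×ˢ K₁) :=
  hf.comp continuous_swap.continuousOn fun _ hp => mk_mem_prod hp.2 hp.1

/-- Fubini's theorem for delta integrals of continuous functions. -/
theorem deltaIntegral_swap (h₁ : IsScaleOn S₁ a₁ b₁) (h₂ : IsScaleOn S₂ a₂ b₂) {f : ℝ → ℝ → ℝ}
    (hf : ContinuousOn (fun p : ℝ × ℝ => f p.1 p.2) (kappa S₁ ×ˢ kappa S₂)) :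
    deltaIntegral S₁ a₁ b₁ (fun t₁ => deltaIntegral S₂ a₂ b₂ fun t₂ => f t₁ t₂) =
      deltaIntegral S₂ a₂ b₂ (fun t₂ => deltaIntegral S₁ a₁ b₁ fun t₁ => f t₁ t₂) := by
  obtain ⟨g, M, hg, hM, hfg⟩ := exists_bounded_continuous_eqOn
    (h₁.isScaleOn_kappa.isCompact.prod h₂.isScaleOn_kappa.isCompact) hf
  rw [deltaIntegral_congr₂ h₁ h₂ (g := fun t₁ t₂ => g (t₁, t₂))
      fun t₁ ht₁ t₂ ht₂ => hfg (mk_mem_prod ht₁ ht₂),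
    deltaIntegral_congr₂ h₂ h₁ (f := fun t₂ t₁ => f t₁ t₂) (g := fun t₂ t₁ => g (t₁, t₂))
      fun t₂ ht₂ t₁ ht₁ => hfg (mk_mem_prod ht₁ ht₂)]
  exact intervalIntegral_intervalIntegral_swap (integrableOn_comp_floorPt hg hM _ _ _ _)

theorem deltaIntegral_add₂ (h₁ : IsScaleOn S₁ a₁ b₁) (h₂ : IsScaleOn S₂ a₂ b₂) {f g : ℝ → ℝ → ℝ}
    (hf : ContinuousOn (fun p : ℝ × ℝ => f p.1 p.2) (kappa S₁ ×ˢ kappa S₂))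
    (hg : ContinuousOn (fun p : ℝ × ℝ => g p.1 p.2) (kappa S₁ ×ˢ kappa S₂)) :
    deltaIntegral S₁ a₁ b₁ (fun t₁ => deltaIntegral S₂ a₂ b₂ fun t₂ => f t₁ t₂ + g t₁ t₂) =
      deltaIntegral S₁ a₁ b₁ (fun t₁ => deltaIntegral S₂ a₂ b₂ (f t₁)) +
        deltaIntegral S₁ a₁ b₁ (fun t₁ => deltaIntegral S₂ a₂ b₂ (g t₁)) := by
  rw [← deltaIntegral_add h₁ (continuousOn_deltaIntegral h₂ h₁.isScaleOn_kappa.isCompact hf)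
    (continuousOn_deltaIntegral h₂ h₁.isScaleOn_kappa.isCompact hg)]
  exact deltaIntegral_congr h₁ fun t₁ ht₁ =>
    deltaIntegral_add h₂ (continuousOn_curry hf ht₁) (continuousOn_curry hg ht₁)

theorem hasIteratedDeltaIntegral_deltaIntegral {T₁ T₂ : Set ℝ}
    (h₁ : IsScaleOn (T₁ ∩ Icc a₁ b₁) a₁ b₁) (h₂ : IsScaleOn (T₂ ∩ Icc a₂ b₂) a₂ b₂)
    {f : ℝ → ℝ → ℝ} (hf : ContinuousOn (fun p : ℝ × ℝ => f p.1 p.2)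
      (kappa (T₁ ∩ Icc a₁ b₁) ×ˢ kappa (T₂ ∩ Icc a₂ b₂))) :
    HasIteratedDeltaIntegral T₁ T₂ f a₁ b₁ a₂ b₂
      (deltaIntegral (T₁ ∩ Icc a₁ b₁) a₁ b₁ fun t₁ =>
        deltaIntegral (T₂ ∩ Icc a₂ b₂) a₂ b₂ (f t₁)) :=
  ⟨fun t₁ => deltaIntegral (T₂ ∩ Icc a₂ b₂) a₂ b₂ (f t₁),
    fun _ ht₁ => hasDeltaIntegral_deltaIntegral h₂ (continuousOn_curry hf ht₁),
    hasDeltaIntegral_deltaIntegral h₁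
      (continuousOn_deltaIntegral h₂ h₁.isScaleOn_kappa.isCompact hf)⟩

/-! ### Riemann sums -/

namespace IsDeltaPartition

variable {T : Set ℝ} {δ : ℝ} {n : ℕ} {p : ℕ → ℝ}

theorem le_of_le (hp : IsDeltaPartition T a b δ n p) {i j : ℕ} (hij : i ≤ j) (hj : j ≤ n) :
    p i ≤ p j := by
  induction j, hij using Nat.le_induction with
  | base => exact le_rfl
  | succ j _ ih => exact (ih (by omega)).trans (hp.2.2.2.1 j (by omega)).le

theorem mem_Icc (hp : IsDeltaPartition T a b δ n p) {i : ℕ} (hi : i ≤ n) : p i ∈ Icc a b := by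
  have h0 := hp.le_of_le (Nat.zero_le i) hi
  have h1 := hp.le_of_le hi le_rfl
  rw [hp.1] at h0
  rw [hp.2.1] at h1
  exact ⟨h0, h1⟩

theorem sum_sub (hp : IsDeltaPartition T a b δ n p) :
    ∑ i ∈ Finset.range n, (p (i + 1) - p i) = b - a := by
  rw [Finset.sum_range_sub, hp.1, hp.2.1]

theorem mem_kappa (hp : IsDeltaPartition T a b δ n p) (h : IsScaleOn (T ∩ Icc a b) a b) {i : ℕ}
    (hi : i < n) {r : ℝ} (hr : r ∈ T ∩ Ico (p i) (p (i + 1))) : r ∈ kappa (T ∩ Icc a b) := by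
  have h1 := (hp.mem_Icc hi.le).1.trans hr.2.1
  have h2 := hr.2.2.trans_le (hp.mem_Icc (i := i + 1) hi).2
  exact h.mem_kappa_of_lt ⟨hr.1, h1, h2.le⟩ h2

theorem floorPt_mem (hp : IsDeltaPartition T a b δ n p) (h : IsScaleOn (T ∩ Icc a b) a b) {i : ℕ}
    (hi : i < n) {z : ℝ} (hz : z ∈ Ioo (p i) (p (i + 1))) :
    floorPt (T ∩ Icc a b) a z ∈ T ∩ Ico (p i) (p (i + 1)) := by
  have h1 := hp.mem_Icc hi.le
  exact ⟨h.floorPt_mem.1, h.le_floorPt ⟨hp.2.2.1 i hi.le, h1⟩ hz.1.le,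
    (IsScaleOn.floorPt_le (h1.1.trans hz.1.le)).trans_lt hz.2⟩

/-- Two points of the time scale in the same cell are `δ`-close: if the cell is longer than `δ`,
its left end is the only point of the time scale in it. -/
theorem abs_sub_le (hp : IsDeltaPartition T a b δ n p) (hδ : 0 ≤ δ) {i : ℕ}
    (hi : i < n) {r s : ℝ} (hr : r ∈ T ∩ Ico (p i) (p (i + 1)))
    (hs : s ∈ T ∩ Ico (p i) (p (i + 1))) : |r - s| ≤ δ := by
  rcases hp.2.2.2.2 i hi with hle | hρ
  · rw [abs_le]
    constructor <;> linarith [hr.2.1, hr.2.2, hs.2.1, hs.2.2]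
  · have h1 := IsScaleOn.le_backwardJump_of_lt hr.1 hr.2.2
    have h2 := IsScaleOn.le_backwardJump_of_lt hs.1 hs.2.2
    rw [hρ] at h1 h2
    rw [le_antisymm h1 hr.2.1, le_antisymm h2 hs.2.1, sub_self, abs_zero]
    exact hδ

end IsDeltaPartition

/-- The Riemann sums of a continuous function converge to its iterated delta integral: on each cell
the function differs from its value at the tag by its oscillation at most. -/
theorem hasDoubleDeltaIntegral_deltaIntegral {T₁ T₂ : Set ℝ}
    (h₁ : IsScaleOn (T₁ ∩ Icc a₁ b₁) a₁ b₁) (h₂ : IsScaleOn (T₂ ∩ Icc a₂ b₂) a₂ b₂)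
    {f : ℝ → ℝ → ℝ} (hf : ContinuousOn (fun p : ℝ × ℝ => f p.1 p.2)
      (kappa (T₁ ∩ Icc a₁ b₁) ×ˢ kappa (T₂ ∩ Icc a₂ b₂))) :
    HasDoubleDeltaIntegral T₁ T₂ f a₁ b₁ a₂ b₂
      (deltaIntegral (T₁ ∩ Icc a₁ b₁) a₁ b₁ fun t₁ =>
        deltaIntegral (T₂ ∩ Icc a₂ b₂) a₂ b₂ (f t₁)) := by
  have hK := h₁.isScaleOn_kappa.isCompact.prod h₂.isScaleOn_kappa.isCompact
  constructor
  · obtain ⟨M, hM⟩ := hK.exists_bound_of_continuousOn hf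
    exact ⟨M, fun t₁ ht₁ t₂ ht₂ => hM (t₁, t₂)
      ⟨h₁.mem_kappa_of_lt ⟨ht₁.1, ht₁.2.1, ht₁.2.2.le⟩ ht₁.2.2,
        h₂.mem_kappa_of_lt ⟨ht₂.1, ht₂.2.1, ht₂.2.2.le⟩ ht₂.2.2⟩⟩
  intro ε hε
  have hA₁ : 0 ≤ b₁ - a₁ := sub_nonneg.2 h₁.le
  have hA₂ : 0 ≤ b₂ - a₂ := sub_nonneg.2 h₂.le
  set ε' := ε / ((b₁ - a₁) * (b₂ - a₂) + 1) with hε'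
  have hε'pos : 0 < ε' := by positivity
  have hε'lt : ε' * ((b₁ - a₁) * (b₂ - a₂)) < ε := by
    rw [hε', div_mul_eq_mul_div, div_lt_iff₀ (by positivity)]
    linarith
  obtain ⟨δ, hδ, hunif⟩ := Metric.uniformContinuousOn_iff.1
    (hK.uniformContinuousOn_of_continuous hf) ε' hε'pos
  refine ⟨δ / 2, by positivity, fun n m x y ξ ζ hx hy htag => ?_⟩
  obtain ⟨g, M, hg, hM, hfg⟩ := exists_bounded_continuous_eqOn hK hf
  rw [deltaIntegral_congr₂ h₁ h₂ (g := fun t₁ t₂ => g (t₁, t₂))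
    fun t₁ ht₁ t₂ ht₂ => hfg (mk_mem_prod ht₁ ht₂)]
  set π₁ := floorPt (T₁ ∩ Icc a₁ b₁) a₁
  set π₂ := floorPt (T₂ ∩ Icc a₂ b₂) a₂
  have hint : ∀ p q r : ℝ, IntervalIntegrable (fun v => g (r, π₂ v)) volume p q := fun p q r =>
    intervalIntegrable_of_bounded (M := M)
      ((by fun_prop : Continuous fun t => g (r, t)).measurable.comp monotone_floorPt.measurable)
      fun v => hM _
  have hint' : ∀ p q r s : ℝ,
      IntervalIntegrable (fun w => ∫ v in r..s, g (π₁ w, π₂ v)) volume p q := fun p q r s =>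
    intervalIntegrable_of_bounded (M := M * |s - r|)
      ((continuous_integral_comp_floorPt hg hM r s).measurable.comp monotone_floorPt.measurable)
      fun w => abs_integral_le_of_abs_le_uIoo fun v _ => hM _
  have hsplit : (deltaIntegral (T₁ ∩ Icc a₁ b₁) a₁ b₁ fun t₁ =>
      deltaIntegral (T₂ ∩ Icc a₂ b₂) a₂ b₂ fun t₂ => g (t₁, t₂)) =
      ∑ i ∈ Finset.range n, ∑ j ∈ Finset.range m,
        ∫ w in x i..x (i + 1), ∫ v in y j..y (j + 1), g (π₁ w, π₂ v) := by
    have e1 : ∀ w, ∑ j ∈ Finset.range m, ∫ v in y j..y (j + 1), g (π₁ w, π₂ v) =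
        ∫ v in a₂..b₂, g (π₁ w, π₂ v) := fun w => by
      rw [intervalIntegral.sum_integral_adjacent_intervals fun j _ => hint _ _ _, hy.1, hy.2.1]
    simp_rw [← intervalIntegral.integral_finsetSum fun j _ => hint' _ _ _ _, e1]
    rw [intervalIntegral.sum_integral_adjacent_intervals fun j _ => hint' _ _ _ _, hx.1, hx.2.1]
    rfl
  have hcell : ∀ i ∈ Finset.range n, ∀ j ∈ Finset.range m,
      |f (ξ i j) (ζ i j) * ((x (i + 1) - x i) * (y (j + 1) - y j)) -
        ∫ w in x i..x (i + 1), ∫ v in y j..y (j + 1), g (π₁ w, π₂ v)| ≤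
      ε' * ((x (i + 1) - x i) * (y (j + 1) - y j)) := by
    intro i hi j hj
    rw [Finset.mem_range] at hi hj
    have hxi := (hx.2.2.2.1 i hi).le
    have hyj := (hy.2.2.2.1 j hj).le
    obtain ⟨hξ, hζ⟩ := htag i hi j hj
    have hpt : ∀ w ∈ Ioo (x i) (x (i + 1)), ∀ v ∈ Ioo (y j) (y (j + 1)),
        |f (ξ i j) (ζ i j) - g (π₁ w, π₂ v)| ≤ ε' := by
      intro w hw v hv
      have hw' := hx.floorPt_mem h₁ hi hw
      have hv' := hy.floorPt_mem h₂ hj hv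
      have hm := mk_mem_prod (hx.mem_kappa h₁ hi hw') (hy.mem_kappa h₂ hj hv')
      have hd : dist (ξ i j, ζ i j) (π₁ w, π₂ v) < δ := by
        rw [Prod.dist_eq, Real.dist_eq, Real.dist_eq]
        have e1 := hx.abs_sub_le (by positivity) hi hξ hw'
        have e2 := hy.abs_sub_le (by positivity) hj hζ hv'
        exact max_lt (by linarith) (by linarith)
      have h3 := hunif _ (mk_mem_prod (hx.mem_kappa h₁ hi hξ) (hy.mem_kappa h₂ hj hζ)) _ hm hd
      rw [← hfg hm, ← Real.dist_eq]
      exact h3.le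
    have e : f (ξ i j) (ζ i j) * ((x (i + 1) - x i) * (y (j + 1) - y j)) -
        (∫ w in x i..x (i + 1), ∫ v in y j..y (j + 1), g (π₁ w, π₂ v)) =
        ∫ w in x i..x (i + 1), ∫ v in y j..y (j + 1),
          (f (ξ i j) (ζ i j) - g (π₁ w, π₂ v)) := by
      simp_rw [intervalIntegral.integral_sub intervalIntegrable_const (hint _ _ _)]
      rw [intervalIntegral.integral_sub intervalIntegrable_const (hint' _ _ _ _)]
      simp only [intervalIntegral.integral_const, smul_eq_mul]
      ring
    rw [e]
    refine (abs_integral_le_of_abs_le_uIoo (C := ε' * |y (j + 1) - y j|) fun w hw => ?_).trans ?_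
    · rw [uIoo_of_le hxi] at hw
      refine abs_integral_le_of_abs_le_uIoo fun v hv => ?_
      rw [uIoo_of_le hyj] at hv
      exact hpt w hw v hv
    · rw [abs_of_nonneg (sub_nonneg.2 hxi), abs_of_nonneg (sub_nonneg.2 hyj)]
      exact le_of_eq (by ring)
  rw [hsplit, ← Finset.sum_sub_distrib]
  simp_rw [← Finset.sum_sub_distrib]
  calc _ ≤ ∑ i ∈ Finset.range n, ∑ j ∈ Finset.range m,
        ε' * ((x (i + 1) - x i) * (y (j + 1) - y j)) :=
        (Finset.abs_sum_le_sum_abs _ _).trans <| Finset.sum_le_sum fun i hi =>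
          (Finset.abs_sum_le_sum_abs _ _).trans <| Finset.sum_le_sum fun j hj => hcell i hi j hj
    _ = ε' * ((b₁ - a₁) * (b₂ - a₂)) := by
        rw [← hx.sum_sub, ← hy.sum_sub, Finset.sum_mul_sum, Finset.mul_sum]
        exact Finset.sum_congr rfl fun i _ => (Finset.mul_sum _ _ _).symm
    _ < ε := hε'lt

/-! ### Integration by parts -/

/-- If `σ` is continuous on `S^k` and the maximum `b` is left-scattered, then `ρ(b)` is not
left-dense, hence does not belong to `S^{k²}`. So the forward jumps of `S^k` and of `S` agree on
`S^{k²}`. -/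
theorem forwardJump_kappa (h : IsScaleOn S a b) (hac : a < backwardJump S b)
    (hσ : ContinuousOn (forwardJump S) (kappa S)) (ht : t ∈ kappa (kappa S)) :
    forwardJump (kappa S) t = forwardJump S t := by
  set c := backwardJump S b
  have hk : IsScaleOn (kappa S) a c := h.isScaleOn_kappa
  have hkS : kappa S ⊆ S := sep_subset _ _
  rcases h.backwardJump_right_le.lt_or_eq with hcb | hcb
  · have htc : t < c := by
      refine lt_of_le_of_ne (hk.le_right ht.1) ?_
      rintro rfl
      -- otherwise `c` is left-dense and `σ` jumps there from values `≤ c` to the value `b`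
      have hσc := h.forwardJump_backwardJump_right hcb
      obtain ⟨δ, hδ, H⟩ := Metric.continuousWithinAt_iff.1 (hσ c hk.right_mem) (b - c)
        (sub_pos.2 hcb)
      obtain ⟨s, hs, hsc, hne⟩ := hk.exists_ne_forwardJump hac ht hδ
      rw [hk.forwardJump_right] at hne
      have h1 := H hs (by rwa [Real.dist_eq])
      have h2 : forwardJump S s ≤ c := IsScaleOn.forwardJump_le_of_lt (hkS hk.right_mem)
        (lt_of_le_of_ne (hk.le_right hs) hne)
      rw [hσc, Real.dist_eq, abs_lt] at h1
      linarith [h1.1]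
    have hne : (kappa S ∩ Ioi t).Nonempty := ⟨c, hk.right_mem, htc⟩
    refine le_antisymm ?_ ?_
    · have e : forwardJump S t = sInf (S ∩ Ioi t) :=
        if_pos (hne.mono (inter_subset_inter_left _ hkS))
      rw [e]
      refine le_csInf (hne.mono (inter_subset_inter_left _ hkS)) fun s hs => ?_
      rcases le_or_gt s c with hsc | hsc
      · refine IsScaleOn.forwardJump_le_of_lt ?_ hs.2
        rw [h.kappa_eq]
        exact ⟨hs.1, h.left_le hs.1, hsc⟩
      · exact (hk.le_right hk.forwardJump_mem).trans hsc.le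
    · have e : forwardJump (kappa S) t = sInf (kappa S ∩ Ioi t) := if_pos hne
      rw [e]
      exact le_csInf hne fun s hs => IsScaleOn.forwardJump_le_of_lt (hkS hs.1) hs.2
  · have e : kappa S = S := by
      rw [h.kappa_eq, show backwardJump S b = b from hcb, h.inter_Icc]
    rw [e]

/-- Integration by parts against a function vanishing at both ends. The boundary term `F(c) G(c)`
at `c = ρ(b)` cancels the part of the integral over the last gap `[c, b)`. -/
theorem deltaIntegral_mul_eq_neg (h : IsScaleOn S a b)
    (hσ : ContinuousOn (forwardJump S) (kappa S)) {F D G g : ℝ → ℝ}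
    (hF : ContinuousOn F (kappa S)) (hD : ContinuousOn D (kappa (kappa S)))
    (hFD : ∀ t ∈ kappa (kappa S), HasDeltaDerivAt (kappa S) F (D t) t)
    (hG : ContinuousOn G S) (hg : ContinuousOn g (kappa S))
    (hGg : ∀ t ∈ kappa S, HasDeltaDerivAt S G (g t) t) (hGa : G a = 0) (hGb : G b = 0) :
    deltaIntegral S a b (fun t => F t * g t) =
      -deltaIntegral (kappa S) a (backwardJump S b) (fun t => D t * G (forwardJump S t)) := by
  rw [deltaIntegral_eq_kappa_add h (f := fun t => F t * g t) (hF.mul hg)]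
  set c := backwardJump S b
  have hk : IsScaleOn (kappa S) a c := h.isScaleOn_kappa
  have hkS : kappa S ⊆ S := sep_subset _ _
  have hkk : kappa (kappa S) ⊆ kappa S := sep_subset _ _
  have hgc : g c * (b - c) = -G c := by
    rcases h.backwardJump_right_le.lt_or_eq with hcb | hcb
    · have h1 := (hGg c hk.right_mem).apply_forwardJump
      rw [h.forwardJump_backwardJump_right hcb, hGb] at h1
      linarith
    · have hcb' : c = b := hcb
      rw [hcb', hGb]
      simp
  have key : deltaIntegral (kappa S) a c (fun t => F t * g t) +
      deltaIntegral (kappa S) a c (fun t => D t * G (forwardJump S t)) = F c * G c := by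
    rcases hk.le.lt_or_eq with hac | hac
    · have hFg : ContinuousOn (fun t => F t * g t) (kappa (kappa S)) := (hF.mul hg).mono hkk
      have hDG : ContinuousOn (fun t => D t * G (forwardJump S t)) (kappa (kappa S)) :=
        hD.mul (hG.comp (hσ.mono hkk) fun _ _ => h.forwardJump_mem)
      rw [← deltaIntegral_add hk hFg hDG,
        deltaIntegral_eq_sub hk (F := fun t => F t * G t)
          (f := fun t => F t * g t + D t * G (forwardJump S t)) (hFg.add hDG),
        hGa, mul_zero, sub_zero]
      intro t ht
      have hj := forwardJump_kappa h hac hσ ht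
      have h1 := (hFD t ht).mul ((hGg t (hkk ht)).mono hkS ht hj)
      rwa [hj] at h1
    -- here `S^k = {a}`, where `D` is arbitrary, but the interval of integration is empty
    · rw [← hac, hGa]
      simp [deltaIntegral]
  linear_combination key + F c * hgc

theorem deltaIntegral_eq_kappa (h : IsScaleOn S a b) {f : ℝ → ℝ} (hf : ContinuousOn f (kappa S))
    (h0 : backwardJump S b < b → f (backwardJump S b) = 0) :
    deltaIntegral S a b f = deltaIntegral (kappa S) a (backwardJump S b) f := by
  rw [deltaIntegral_eq_kappa_add h hf]
  rcases h.backwardJump_right_le.lt_or_eq with hcb | hcb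
  · rw [h0 hcb, zero_mul, add_zero]
  · rw [hcb, sub_self, mul_zero, add_zero]

theorem deltaIntegral_of_eqOn_zero (h : IsScaleOn S a b) {f : ℝ → ℝ}
    (h0 : ∀ t ∈ kappa S, f t = 0) : deltaIntegral S a b f = 0 := by
  rw [deltaIntegral_congr h (g := fun _ => 0) h0]
  simp [deltaIntegral]

/-- An integrand vanishing on the last gap of each time scale. -/
theorem deltaIntegral_eq_kappa₂ (h₁ : IsScaleOn S₁ a₁ b₁) (h₂ : IsScaleOn S₂ a₂ b₂)
    {f : ℝ → ℝ → ℝ} (hf : ContinuousOn (fun p : ℝ × ℝ => f p.1 p.2) (kappa S₁ ×ˢ kappa S₂))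
    (h0₁ : backwardJump S₁ b₁ < b₁ → ∀ t₂ ∈ kappa S₂, f (backwardJump S₁ b₁) t₂ = 0)
    (h0₂ : backwardJump S₂ b₂ < b₂ → ∀ t₁ ∈ kappa S₁, f t₁ (backwardJump S₂ b₂) = 0) :
    deltaIntegral S₁ a₁ b₁ (fun t₁ => deltaIntegral S₂ a₂ b₂ (f t₁)) =
      deltaIntegral (kappa S₁) a₁ (backwardJump S₁ b₁)
        (fun t₁ => deltaIntegral (kappa S₂) a₂ (backwardJump S₂ b₂) (f t₁)) := by
  rw [deltaIntegral_eq_kappa h₁ (continuousOn_deltaIntegral h₂ h₁.isScaleOn_kappa.isCompact hf)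
    fun hc => deltaIntegral_of_eqOn_zero h₂ (h0₁ hc)]
  exact deltaIntegral_congr h₁.isScaleOn_kappa fun t₁ ht₁ =>
    deltaIntegral_eq_kappa h₂ (continuousOn_curry hf ht₁.1) fun hc => h0₂ hc t₁ ht₁.1

/-- Integration by parts in the inner variable of an iterated integral. The last gap of the outer
time scale does not contribute, as the factor `g` vanishes there. -/
theorem deltaIntegral_mul_eq_neg₂ (h₁ : IsScaleOn S₁ a₁ b₁) (h₂ : IsScaleOn S₂ a₂ b₂)
    (hσ₂ : ContinuousOn (forwardJump S₂) (kappa S₂)) {F D G g : ℝ → ℝ → ℝ}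
    (hF : ContinuousOn (fun p : ℝ × ℝ => F p.1 p.2) (kappa S₁ ×ˢ kappa S₂))
    (hD : ContinuousOn (fun p : ℝ × ℝ => D p.1 p.2) (kappa (kappa S₁) ×ˢ kappa (kappa S₂)))
    (hFD : ∀ t₁ ∈ kappa (kappa S₁), ∀ t₂ ∈ kappa (kappa S₂),
      HasDeltaDerivAt (kappa S₂) (F t₁) (D t₁ t₂) t₂)
    (hG : ∀ t₁ ∈ kappa S₁, ContinuousOn (G t₁) S₂)
    (hg : ContinuousOn (fun p : ℝ × ℝ => g p.1 p.2) (kappa S₁ ×ˢ kappa S₂))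
    (hGg : ∀ t₁ ∈ kappa S₁, ∀ t₂ ∈ kappa S₂, HasDeltaDerivAt S₂ (G t₁) (g t₁ t₂) t₂)
    (hG0 : ∀ t₁ ∈ kappa S₁, G t₁ a₂ = 0 ∧ G t₁ b₂ = 0)
    (hg0 : backwardJump S₁ b₁ < b₁ → ∀ t₂ ∈ kappa S₂, g (backwardJump S₁ b₁) t₂ = 0) :
    deltaIntegral S₁ a₁ b₁ (fun t₁ => deltaIntegral S₂ a₂ b₂ fun t₂ => F t₁ t₂ * g t₁ t₂) =
      deltaIntegral (kappa S₁) a₁ (backwardJump S₁ b₁)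
        (fun t₁ => deltaIntegral (kappa S₂) a₂ (backwardJump S₂ b₂)
          fun t₂ => -(D t₁ t₂ * G t₁ (forwardJump S₂ t₂))) := by
  rw [deltaIntegral_eq_kappa h₁
    (continuousOn_deltaIntegral h₂ h₁.isScaleOn_kappa.isCompact (hF.mul hg))
    fun hc => deltaIntegral_of_eqOn_zero h₂ fun t₂ ht₂ => by rw [hg0 hc t₂ ht₂, mul_zero]]
  refine deltaIntegral_congr h₁.isScaleOn_kappa fun t₁ ht₁ => ?_
  rw [deltaIntegral_neg]
  exact deltaIntegral_mul_eq_neg h₂ hσ₂ (continuousOn_curry hF ht₁.1) (continuousOn_curry hD ht₁)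
    (hFD t₁ ht₁) (hG t₁ ht₁.1) (continuousOn_curry hg ht₁.1) (hGg t₁ ht₁.1) (hG0 t₁ ht₁.1).1
    (hG0 t₁ ht₁.1).2

end TimeScale

/-! ### The first variation -/

theorem mainTheorem1
    -- time scales, and the intervals `Sᵢ = [aᵢ, bᵢ] ∩ Tᵢ` as time scales in their own right
    (T₁ T₂ S₁ S₂ : Set ℝ) (a₁ b₁ a₂ b₂ : ℝ)
    (hT₁ : IsClosed T₁) (hT₂ : IsClosed T₂)
    (ha₁ : a₁ ∈ T₁) (hb₁ : b₁ ∈ T₁) (hab₁ : a₁ < b₁)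
    (ha₂ : a₂ ∈ T₂) (hb₂ : b₂ ∈ T₂) (hab₂ : a₂ < b₂)
    (hS₁ : S₁ = T₁ ∩ Set.Icc a₁ b₁) (hS₂ : S₂ = T₂ ∩ Set.Icc a₂ b₂)
    -- the forward jump operators are delta differentiable
    (hσ₁ : ∀ t ∈ kappa S₁, ∃ c, HasDeltaDerivAt S₁ (forwardJump S₁) c t)
    (hσ₂ : ∀ t ∈ kappa S₂, ∃ c, HasDeltaDerivAt S₂ (forwardJump S₂) c t)
    -- the Lagrangian and its partial derivatives in `y₀, y₁, y₂`
    (L L₀ L₁ L₂ : ℝ → ℝ → ℝ → ℝ → ℝ → ℝ)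
    (hL₀ : ∀ t₁ ∈ kappa S₁, ∀ t₂ ∈ kappa S₂, ∀ y₀ y₁ y₂ : ℝ,
      HasDerivAt (fun y => L t₁ t₂ y y₁ y₂) (L₀ t₁ t₂ y₀ y₁ y₂) y₀)
    (hL₁ : ∀ t₁ ∈ kappa S₁, ∀ t₂ ∈ kappa S₂, ∀ y₀ y₁ y₂ : ℝ,
      HasDerivAt (fun y => L t₁ t₂ y₀ y y₂) (L₁ t₁ t₂ y₀ y₁ y₂) y₁)
    (hL₂ : ∀ t₁ ∈ kappa S₁, ∀ t₂ ∈ kappa S₂, ∀ y₀ y₁ y₂ : ℝ,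
      HasDerivAt (fun y => L t₁ t₂ y₀ y₁ y) (L₂ t₁ t₂ y₀ y₁ y₂) y₂)
    -- the function `u` and its partial delta derivatives
    (u u₁ u₂ : ℝ → ℝ → ℝ) (hu : HasPartialDeltaDerivs S₁ S₂ u u₁ u₂)
    -- smoothness of `L` along `u`
    (hc₀ : ContinuousOn (fun p : ℝ × ℝ => along S₁ S₂ u u₁ u₂ L₀ p.1 p.2) (kappa S₁ ×ˢ kappa S₂))
    (hc₁ : ContinuousOn (fun p : ℝ × ℝ => along S₁ S₂ u u₁ u₂ L₁ p.1 p.2) (kappa S₁ ×ˢ kappa S₂))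
    (hc₂ : ContinuousOn (fun p : ℝ × ℝ => along S₁ S₂ u u₁ u₂ L₂ p.1 p.2) (kappa S₁ ×ˢ kappa S₂))
    -- `D₁ = L_{y₁}^{Δ₁}` and `D₂ = L_{y₂}^{Δ₂}`, the partial delta derivatives along `u`
    (D₁ D₂ : ℝ → ℝ → ℝ)
    (hD₁ : ∀ t₁ ∈ kappa (kappa S₁), ∀ t₂ ∈ kappa (kappa S₂),
      HasDeltaDerivAt (kappa S₁) (fun s => along S₁ S₂ u u₁ u₂ L₁ s t₂) (D₁ t₁ t₂) t₁)
    (hD₂ : ∀ t₁ ∈ kappa (kappa S₁), ∀ t₂ ∈ kappa (kappa S₂),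
      HasDeltaDerivAt (kappa S₂) (fun s => along S₁ S₂ u u₁ u₂ L₂ t₁ s) (D₂ t₁ t₂) t₂)
    (hDc₁ : ContinuousOn (fun p : ℝ × ℝ => D₁ p.1 p.2) (kappa (kappa S₁) ×ˢ kappa (kappa S₂)))
    (hDc₂ : ContinuousOn (fun p : ℝ × ℝ => D₂ p.1 p.2) (kappa (kappa S₁) ×ˢ kappa (kappa S₂)))
    -- the variation `η`, vanishing on the boundary of `R = S₁ × S₂`
    (η η₁ η₂ : ℝ → ℝ → ℝ) (hη : HasPartialDeltaDerivs S₁ S₂ η η₁ η₂)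
    (hηc : ContinuousOn (fun p : ℝ × ℝ => η p.1 p.2) (S₁ ×ˢ S₂))
    (hηc₁ : ContinuousOn (fun p : ℝ × ℝ => η₁ p.1 p.2) (kappa S₁ ×ˢ S₂))
    (hηc₂ : ContinuousOn (fun p : ℝ × ℝ => η₂ p.1 p.2) (S₁ ×ˢ kappa S₂))
    (hηb₁ : ∀ t₂ ∈ S₂, η a₁ t₂ = 0 ∧ η b₁ t₂ = 0)
    (hηb₂ : ∀ t₁ ∈ S₁, η t₁ a₂ = 0 ∧ η t₁ b₂ = 0)
    -- the integrand of the first variation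
    (V : ℝ → ℝ → ℝ)
    (hV : ∀ t₁ t₂, V t₁ t₂ =
      along S₁ S₂ u u₁ u₂ L₀ t₁ t₂ * η (forwardJump S₁ t₁) (forwardJump S₂ t₂)
        + along S₁ S₂ u u₁ u₂ L₁ t₁ t₂ * η₁ t₁ (forwardJump S₂ t₂)
        + along S₁ S₂ u u₁ u₂ L₂ t₁ t₂ * η₂ (forwardJump S₁ t₁) t₂)
    -- the integrand of the reduced first variation
    (W : ℝ → ℝ → ℝ)
    (hW : ∀ t₁ t₂, W t₁ t₂ =
      (along S₁ S₂ u u₁ u₂ L₀ t₁ t₂ - D₁ t₁ t₂ - D₂ t₁ t₂)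
        * η (forwardJump S₁ t₁) (forwardJump S₂ t₂)) :
    -- both integrals exist, as double Riemann integrals and as iterated integrals, and they agree
    ∃ I : ℝ,
      HasDoubleDeltaIntegral S₁ S₂ V a₁ b₁ a₂ b₂ I ∧
      HasIteratedDeltaIntegral S₁ S₂ V a₁ b₁ a₂ b₂ I ∧
      HasDoubleDeltaIntegral S₁ S₂ W a₁ (backwardJump S₁ b₁) a₂ (backwardJump S₂ b₂) I ∧
      HasIteratedDeltaIntegral S₂ S₁ (fun t₂ t₁ => W t₁ t₂)
        a₂ (backwardJump S₂ b₂) a₁ (backwardJump S₁ b₁) I := by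
  have h₁ : IsScaleOn S₁ a₁ b₁ := hS₁ ▸ isScaleOn_inter_Icc hT₁ ha₁ hb₁ hab₁.le
  have h₂ : IsScaleOn S₂ a₂ b₂ := hS₂ ▸ isScaleOn_inter_Icc hT₂ ha₂ hb₂ hab₂.le
  clear hT₁ hT₂ ha₁ hb₁ ha₂ hb₂ hS₁ hS₂ hL₀ hL₁ hL₂ hu
  have hkS₁ : kappa S₁ ⊆ S₁ := sep_subset _ _
  have hkS₂ : kappa S₂ ⊆ S₂ := sep_subset _ _
  have hkk₁ : kappa (kappa S₁) ⊆ kappa S₁ := sep_subset _ _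
  have hkk₂ : kappa (kappa S₂) ⊆ kappa S₂ := sep_subset _ _
  have hσc₁ : ContinuousOn (forwardJump S₁) (kappa S₁) := fun t ht =>
    (hσ₁ t ht).choose_spec.continuousWithinAt.mono hkS₁
  have hσc₂ : ContinuousOn (forwardJump S₂) (kappa S₂) := fun t ht =>
    (hσ₂ t ht).choose_spec.continuousWithinAt.mono hkS₂
  have hσ'₁ : ContinuousOn (fun p : ℝ × ℝ => forwardJump S₁ p.1) (kappa S₁ ×ˢ kappa S₂) :=
    hσc₁.comp continuousOn_fst fun _ hp => hp.1
  have hσ'₂ : ContinuousOn (fun p : ℝ × ℝ => forwardJump S₂ p.2) (kappa S₁ ×ˢ kappa S₂) :=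
    hσc₂.comp continuousOn_snd fun _ hp => hp.2
  have hησ : ContinuousOn (fun p : ℝ × ℝ => η (forwardJump S₁ p.1) (forwardJump S₂ p.2))
      (kappa S₁ ×ˢ kappa S₂) :=
    hηc.comp (hσ'₁.prodMk hσ'₂) fun _ _ => mk_mem_prod h₁.forwardJump_mem h₂.forwardJump_mem
  have hη₁σ : ContinuousOn (fun p : ℝ × ℝ => η₁ p.1 (forwardJump S₂ p.2))
      (kappa S₁ ×ˢ kappa S₂) :=
    hηc₁.comp (continuousOn_fst.prodMk hσ'₂) fun _ hp => mk_mem_prod hp.1 h₂.forwardJump_mem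
  have hη₂σ : ContinuousOn (fun p : ℝ × ℝ => η₂ (forwardJump S₁ p.1) p.2)
      (kappa S₁ ×ˢ kappa S₂) :=
    hηc₂.comp (hσ'₁.prodMk continuousOn_snd) fun _ hp => mk_mem_prod h₁.forwardJump_mem hp.2
  -- on the edges `tᵢ = bᵢ` the tangential derivative of `η` vanishes with `η`
  have hη₁0 : ∀ t₁ ∈ kappa S₁, η₁ t₁ b₂ = 0 := fun t₁ ht₁ =>
    (hη.1 t₁ ht₁ b₂ h₂.right_mem).eq_zero h₁ hab₁ fun s hs => (hηb₂ s hs).2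
  have hη₂0 : ∀ t₂ ∈ kappa S₂, η₂ b₁ t₂ = 0 := fun t₂ ht₂ =>
    (hη.2 b₁ h₁.right_mem t₂ ht₂).eq_zero h₂ hab₂ fun s hs => (hηb₁ s hs).2
  set A : ℝ → ℝ → ℝ := fun t₁ t₂ =>
    along S₁ S₂ u u₁ u₂ L₀ t₁ t₂ * η (forwardJump S₁ t₁) (forwardJump S₂ t₂) with hA
  set B : ℝ → ℝ → ℝ := fun t₁ t₂ =>
    along S₁ S₂ u u₁ u₂ L₁ t₁ t₂ * η₁ t₁ (forwardJump S₂ t₂)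
  set C : ℝ → ℝ → ℝ := fun t₁ t₂ =>
    along S₁ S₂ u u₁ u₂ L₂ t₁ t₂ * η₂ (forwardJump S₁ t₁) t₂
  set B' : ℝ → ℝ → ℝ := fun t₁ t₂ =>
    -(D₁ t₁ t₂ * η (forwardJump S₁ t₁) (forwardJump S₂ t₂)) with hB'
  set C' : ℝ → ℝ → ℝ := fun t₁ t₂ =>
    -(D₂ t₁ t₂ * η (forwardJump S₁ t₁) (forwardJump S₂ t₂)) with hC'
  have hAc : ContinuousOn (fun p : ℝ × ℝ => A p.1 p.2) (kappa S₁ ×ˢ kappa S₂) := hc₀.mul hησ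
  have hBc : ContinuousOn (fun p : ℝ × ℝ => B p.1 p.2) (kappa S₁ ×ˢ kappa S₂) := hc₁.mul hη₁σ
  have hCc : ContinuousOn (fun p : ℝ × ℝ => C p.1 p.2) (kappa S₁ ×ˢ kappa S₂) := hc₂.mul hη₂σ
  have hkk := prod_mono hkk₁ hkk₂
  have hB'c : ContinuousOn (fun p : ℝ × ℝ => B' p.1 p.2)
    (kappa (kappa S₁) ×ˢ kappa (kappa S₂)) := (hDc₁.mul (hησ.mono hkk)).neg
  have hC'c : ContinuousOn (fun p : ℝ × ℝ => C' p.1 p.2)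
    (kappa (kappa S₁) ×ˢ kappa (kappa S₂)) := (hDc₂.mul (hησ.mono hkk)).neg
  have hVeq : V = fun t₁ t₂ => A t₁ t₂ + B t₁ t₂ + C t₁ t₂ := by
    funext t₁ t₂; exact hV t₁ t₂
  have hWeq : W = fun t₁ t₂ => A t₁ t₂ + B' t₁ t₂ + C' t₁ t₂ := by
    funext t₁ t₂; rw [hW]; simp only [hA, hB', hC']; ring
  have hk₁ := h₁.isScaleOn_kappa
  have hk₂ := h₂.isScaleOn_kappa
  have hABc : ContinuousOn (fun p : ℝ × ℝ => A p.1 p.2 + B p.1 p.2) (kappa S₁ ×ˢ kappa S₂) :=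
    hAc.add hBc
  have hAB'c : ContinuousOn (fun p : ℝ × ℝ => A p.1 p.2 + B' p.1 p.2)
    (kappa (kappa S₁) ×ˢ kappa (kappa S₂)) := (hAc.mono hkk).add hB'c
  have hVc : ContinuousOn (fun p : ℝ × ℝ => V p.1 p.2) (kappa S₁ ×ˢ kappa S₂) := by
    rw [hVeq]; exact hABc.add hCc
  have hWc : ContinuousOn (fun p : ℝ × ℝ => W p.1 p.2)
      (kappa (kappa S₁) ×ˢ kappa (kappa S₂)) := by
    rw [hWeq]; exact hAB'c.add hC'c
  have hIA := deltaIntegral_eq_kappa₂ h₁ h₂ hAc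
    (fun hc t₂ _ => by
      simp only [hA]
      rw [h₁.forwardJump_backwardJump_right hc, (hηb₁ _ h₂.forwardJump_mem).2, mul_zero])
    (fun hc t₁ _ => by
      simp only [hA]
      rw [h₂.forwardJump_backwardJump_right hc, (hηb₂ _ h₁.forwardJump_mem).2, mul_zero])
  have hIB : deltaIntegral S₁ a₁ b₁ (fun t₁ => deltaIntegral S₂ a₂ b₂ (B t₁)) =
      deltaIntegral (kappa S₁) a₁ (backwardJump S₁ b₁)
        (fun t₁ => deltaIntegral (kappa S₂) a₂ (backwardJump S₂ b₂) (B' t₁)) := by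
    have e1 := deltaIntegral_swap h₁ h₂ hBc
    have e2 := deltaIntegral_swap hk₁ hk₂ hB'c
    refine e1.trans (Eq.trans ?_ e2.symm)
    exact deltaIntegral_mul_eq_neg₂ h₂ h₁ hσc₁
      (F := fun t₂ t₁ => along S₁ S₂ u u₁ u₂ L₁ t₁ t₂) (D := fun t₂ t₁ => D₁ t₁ t₂)
      (G := fun t₂ t₁ => η t₁ (forwardJump S₂ t₂)) (g := fun t₂ t₁ => η₁ t₁ (forwardJump S₂ t₂))
      (continuousOn_prod_swap hc₁) (continuousOn_prod_swap hDc₁)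
      (fun t₂ ht₂ t₁ ht₁ => hD₁ t₁ ht₁ t₂ ht₂)
      (fun t₂ _ => hηc.comp (Continuous.prodMk_left _).continuousOn
        fun _ hs => mk_mem_prod hs h₂.forwardJump_mem)
      (continuousOn_prod_swap (f := fun t₁ t₂ => η₁ t₁ (forwardJump S₂ t₂)) hη₁σ)
      (fun t₂ _ t₁ ht₁ => hη.1 t₁ ht₁ _ h₂.forwardJump_mem)
      (fun t₂ _ => hηb₁ _ h₂.forwardJump_mem)
      (fun hc t₁ ht₁ => by
        rw [h₂.forwardJump_backwardJump_right hc, hη₁0 t₁ ht₁])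
  have hIC : deltaIntegral S₁ a₁ b₁ (fun t₁ => deltaIntegral S₂ a₂ b₂ (C t₁)) =
      deltaIntegral (kappa S₁) a₁ (backwardJump S₁ b₁)
        (fun t₁ => deltaIntegral (kappa S₂) a₂ (backwardJump S₂ b₂) (C' t₁)) :=
    deltaIntegral_mul_eq_neg₂ h₁ h₂ hσc₂
      (F := fun t₁ t₂ => along S₁ S₂ u u₁ u₂ L₂ t₁ t₂) (D := D₂)
      (G := fun t₁ t₂ => η (forwardJump S₁ t₁) t₂) (g := fun t₁ t₂ => η₂ (forwardJump S₁ t₁) t₂)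
      hc₂ hDc₂ hD₂ (fun t₁ _ => continuousOn_curry hηc h₁.forwardJump_mem) hη₂σ
      (fun t₁ _ t₂ ht₂ => hη.2 _ h₁.forwardJump_mem t₂ ht₂)
      (fun t₁ _ => hηb₂ _ h₁.forwardJump_mem)
      (fun hc t₂ ht₂ => by
        rw [h₁.forwardJump_backwardJump_right hc, hη₂0 t₂ ht₂])
  have hVW : deltaIntegral S₁ a₁ b₁ (fun t₁ => deltaIntegral S₂ a₂ b₂ (V t₁)) =
      deltaIntegral (kappa S₁) a₁ (backwardJump S₁ b₁)
        (fun t₁ => deltaIntegral (kappa S₂) a₂ (backwardJump S₂ b₂) (W t₁)) := by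
    rw [hVeq, hWeq]
    have e1 := deltaIntegral_add₂ h₁ h₂ (f := fun t₁ t₂ => A t₁ t₂ + B t₁ t₂) hABc hCc
    have e2 := deltaIntegral_add₂ hk₁ hk₂ (f := fun t₁ t₂ => A t₁ t₂ + B' t₁ t₂) hAB'c hC'c
    rw [e1, e2, deltaIntegral_add₂ h₁ h₂ hAc hBc, deltaIntegral_add₂ hk₁ hk₂ (hAc.mono hkk) hB'c,
      hIA, hIB, hIC]
  refine ⟨deltaIntegral S₁ a₁ b₁ fun t₁ => deltaIntegral S₂ a₂ b₂ (V t₁), ?_, ?_, ?_, ?_⟩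
  · have := hasDoubleDeltaIntegral_deltaIntegral (T₁ := S₁) (T₂ := S₂) (f := V)
      (a₁ := a₁) (b₁ := b₁) (a₂ := a₂) (b₂ := b₂)
    rw [h₁.inter_Icc, h₂.inter_Icc] at this
    exact this h₁ h₂ hVc
  · have := hasIteratedDeltaIntegral_deltaIntegral (T₁ := S₁) (T₂ := S₂) (f := V)
      (a₁ := a₁) (b₁ := b₁) (a₂ := a₂) (b₂ := b₂)
    rw [h₁.inter_Icc, h₂.inter_Icc] at this
    exact this h₁ h₂ hVc
  · have := hasDoubleDeltaIntegral_deltaIntegral (T₁ := S₁) (T₂ := S₂) (f := W)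
      (a₁ := a₁) (b₁ := backwardJump S₁ b₁) (a₂ := a₂) (b₂ := backwardJump S₂ b₂)
    rw [← h₁.kappa_eq, ← h₂.kappa_eq] at this
    rw [hVW]
    exact this hk₁ hk₂ hWc
  · have := hasIteratedDeltaIntegral_deltaIntegral (T₁ := S₂) (T₂ := S₁)
      (f := fun t₂ t₁ => W t₁ t₂)
      (a₁ := a₂) (b₁ := backwardJump S₂ b₂) (a₂ := a₁) (b₂ := backwardJump S₁ b₁)
    rw [← h₁.kappa_eq, ← h₂.kappa_eq] at this
    rw [hVW, deltaIntegral_swap hk₁ hk₂ hWc]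
    exact this hk₂ hk₁ (continuousOn_prod_swap hWc)
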